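/- Let $K$ be a field, let $n\ge 0$ be an integer, and order $\mathbb{Z}_{\ge 0}^n$ componentwise; for $u,v\in\mathbb{Z}_{\ge 0}^n$ write $|u|=u_1+\cdots+u_n$ and let $u\vee v$ be the componentwise maximum. A discrete polymatroid on $\{1,\dots,n\}$ is a nonempty finite set $P\subset\mathbb{Z}_{\ge 0}^n$ such that (i) if $u\in P$, $v\in\mathbb{Z}_{\ge 0}^n$ and $v\le u$, then $v\in P$; and (ii) for all $u,v\in P$ with $|v|>|u|$ there is $w\in P$ with $u<w\le u\vee v$ (where $u<w$ means $u\le w$ and $u\ne w$). Its set of bases $B$ is the set of all $u\in P$ such that $u<v$ for no $v\in P$, and its base ring is the $K$-subalgebra $K[B]=K[t^u : u\in B]$ of the polynomial ring $K[t_1,\dots,t_n]$ generated by the monomials $t^u=t_1^{u_1}\cdots t_n^{u_n}$ with $u\in B$. Corollary 6.2. For every discrete polymatroid $P$ with set of bases $B$, the base ring $K[B]$ is normal, that is, it is an integral domain which is integrally closed in its field of fractions. -/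

import Mathlib

/-- The modulus `|u| = u(1) + ⋯ + u(n)` of a nonnegative integer vector. -/
def vecModulus {n : ℕ} (u : Fin n →₀ ℕ) : ℕ :=
  ∑ i, u i

/-- Discrete polymatroids on the ground set `[n]`. The order and the join `⊔` on
`Fin n →₀ ℕ` are componentwise. -/
structure IsDiscretePolymatroid {n : ℕ} (P : Set (Fin n →₀ ℕ)) : Prop where
  nonempty : P.Nonempty
  finite : P.Finite
  mem_of_le : ∀ u ∈ P, ∀ v : Fin n →₀ ℕ, v ≤ u → v ∈ P
  exchange : ∀ u ∈ P, ∀ v ∈ P, vecModulus u < vecModulus v → ∃ w ∈ P, u < w ∧ w ≤ u ⊔ v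

/-- The set of bases of `P`: the vectors of `P` that lie strictly below no vector of `P`. -/
def polymatroidBases {n : ℕ} (P : Set (Fin n →₀ ℕ)) : Set (Fin n →₀ ℕ) :=
  {u | u ∈ P ∧ ∀ v ∈ P, ¬ u < v}

/-- The base ring `K[B] = K[t^u : u ∈ B]`, where `B` is the set of bases of `P`: the
`K`-subalgebra of `K[t_1, …, t_n]` generated by the monomials `t^u` with `u ∈ B`. -/
noncomputable def baseRing (K : Type*) [Field K] {n : ℕ} (P : Set (Fin n →₀ ℕ)) :
    Subalgebra K (MvPolynomial (Fin n) K) :=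
  Algebra.adjoin K ((fun u => MvPolynomial.monomial u (1 : K)) '' polymatroidBases P)

/-!
The proof has a combinatorial half and an algebraic half.

*Combinatorics.* All bases have the same modulus `d`, and, seen as integer vectors, they form an
M-convex set: if `u i > v i`, then some `j` has `u j < v j` and `u - eᵢ + eⱼ` is again a base.
M-convexity passes to Minkowski sums (`IsMConvex.add`), hence to `k • B`. An M-convex set is cut out
by its inequalities `x(R) ≥ min_{z} z(R)` for subsets `R` of the ground set, together with the value
of the coordinate sum (`IsMConvex.mem_of_forall_sum_le`): if `y` is a member closest to some `x`
that is not a member, the set `R` of coordinates reachable by an exchange from one where `y`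
exceeds `x` satisfies `y(R) > x(R)`, while `y` minimises the `R`-sum over the set, since no exchange
leaves `R`. Therefore the monoid generated by `B` consists of the `x` with `d ∣ |x|` and
`d * x(R) ≥ r * |x|` whenever `r` is a lower bound for the `R`-sums of the bases
(`IsDiscretePolymatroid.mem_closure_bases`).

*Algebra.* The ring `K[B]` consists of the polynomials whose exponents lie in the monoid generated
by `B`. An element of its fraction field integral over it is integral over `K[t]`, so it is a
polynomial `f`, and `g * f ∈ K[B]` for some nonzero `g ∈ K[B]`. Comparing degrees modulo `d`, the
latter gives `d ∣ |x|` for every exponent `x` of `f`. Integrality of `f` gives each linear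
inequality `λ(x) ≥ 0` that holds on `B`: under `tᵢ ↦ tᵢ T ^ λᵢ` the ring `K[B]` lands in `K[t][T]`,
which is integrally closed in `K[t][T;T⁻¹]`
(`MvPolynomial.weight_nonneg_of_isIntegral`).
-/

open scoped Pointwise

/-! ### M-convex sets -/

/-- A set of integer vectors is M-convex if its members have the same coordinate sum and it has the
exchange property: whenever `u i > v i`, a unit can be moved in `u` from `i` to some `j` with
`u j < v j` without leaving the set. The empty set is allowed. -/
structure IsMConvex {ι : Type*} [Fintype ι] [DecidableEq ι] (D : Set (ι → ℤ)) : Prop where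
  sum_eq : ∀ u ∈ D, ∀ v ∈ D, ∑ i, u i = ∑ i, v i
  exchange : ∀ u ∈ D, ∀ v ∈ D, ∀ i, v i < u i →
    ∃ j, u j < v j ∧ u - Pi.single i 1 + Pi.single j 1 ∈ D

section MConvex

variable {ι : Type*} [Fintype ι] [DecidableEq ι]

omit [Fintype ι] in
theorem sub_single_add_single_apply (u : ι → ℤ) (i j k : ι) :
    (u - Pi.single i 1 + Pi.single j 1 : ι → ℤ) k =
      u k - (if k = i then 1 else 0) + (if k = j then 1 else 0) := by
  simp [Pi.single_apply]

/-- The `ℓ¹` distance of integer vectors, as a natural number. -/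
def latticeDist (u v : ι → ℤ) : ℕ := ∑ k, (u k - v k).natAbs

theorem latticeDist_lt_of_exchange {u v : ι → ℤ} {i j : ι} (hi : v i < u i) (hj : u j < v j) :
    latticeDist (u - Pi.single i 1 + Pi.single j 1) v < latticeDist u v := by
  have hij : i ≠ j := by rintro rfl; omega
  refine Finset.sum_lt_sum (fun k _ => ?_) ⟨i, Finset.mem_univ i, ?_⟩
  · rw [sub_single_add_single_apply]
    split_ifs with h1 h2 h2
    · exact absurd (h1.symm.trans h2) hij
    · subst h1; omega
    · subst h2; omega
    · omega
  · rw [sub_single_add_single_apply, if_pos rfl, if_neg hij]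
    omega

omit [Fintype ι] in
theorem sum_sub_single_add_single (R : Finset ι) (u : ι → ℤ) (i j : ι) :
    ∑ k ∈ R, (u - Pi.single i 1 + Pi.single j 1 : ι → ℤ) k =
      ∑ k ∈ R, u k - (if i ∈ R then 1 else 0) + (if j ∈ R then 1 else 0) := by
  simp only [sub_single_add_single_apply, Finset.sum_add_distrib, Finset.sum_sub_distrib,
    Finset.sum_ite_eq']

/-- The exchange property of `D + E`, for given decompositions of the two vectors. An exchange inside
one summand may create a new excess at `j` instead of reducing a deficit; then one continues from
`j`. The total distance of the summands to `v₁` and `v₂` drops each time, so this ends. -/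
theorem IsMConvex.exists_add_exchange {D E : Set (ι → ℤ)} (hD : IsMConvex D) (hE : IsMConvex E)
    {v₁ v₂ : ι → ℤ} (hv₁ : v₁ ∈ D) (hv₂ : v₂ ∈ E) (N : ℕ) :
    ∀ u₁ ∈ D, ∀ u₂ ∈ E, latticeDist u₁ v₁ + latticeDist u₂ v₂ = N → ∀ i,
      v₁ i + v₂ i < u₁ i + u₂ i → ∃ j, u₁ j + u₂ j < v₁ j + v₂ j ∧
        u₁ + u₂ - Pi.single i 1 + Pi.single j 1 ∈ D + E := by
  induction N using Nat.strong_induction_on with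
  | _ N ih =>
  intro u₁ hu₁ u₂ hu₂ hN i hi
  rcases lt_or_ge (v₁ i) (u₁ i) with h | h
  · obtain ⟨j, hj, hm⟩ := hD.exchange u₁ hu₁ v₁ hv₁ i h
    have hij : j ≠ i := by rintro rfl; omega
    by_cases hj' : u₁ j + u₂ j < v₁ j + v₂ j
    · exact ⟨j, hj', _, hm, u₂, hu₂, by simp only; abel⟩
    · have hlt := latticeDist_lt_of_exchange h hj
      obtain ⟨k, hk, hmk⟩ := ih _ (by omega) _ hm u₂ hu₂ rfl j (by
        rw [sub_single_add_single_apply, if_pos rfl, if_neg hij]; omega)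
      rw [sub_single_add_single_apply] at hk
      refine ⟨k, ?_, ?_⟩
      · split_ifs at hk with h1 h2 h2
        · omega
        · subst h1; omega
        · omega
        · omega
      · convert hmk using 1; abel
  · have h' : v₂ i < u₂ i := by omega
    obtain ⟨j, hj, hm⟩ := hE.exchange u₂ hu₂ v₂ hv₂ i h'
    have hij : j ≠ i := by rintro rfl; omega
    by_cases hj' : u₁ j + u₂ j < v₁ j + v₂ j
    · exact ⟨j, hj', u₁, hu₁, _, hm, by simp only; abel⟩
    · have hlt := latticeDist_lt_of_exchange h' hj
      obtain ⟨k, hk, hmk⟩ := ih _ (by omega) u₁ hu₁ _ hm rfl j (by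
        rw [sub_single_add_single_apply, if_pos rfl, if_neg hij]; omega)
      rw [sub_single_add_single_apply] at hk
      refine ⟨k, ?_, ?_⟩
      · split_ifs at hk with h1 h2 h2
        · omega
        · subst h1; omega
        · omega
        · omega
      · convert hmk using 1; abel

theorem IsMConvex.add {D E : Set (ι → ℤ)} (hD : IsMConvex D) (hE : IsMConvex E) :
    IsMConvex (D + E) where
  sum_eq := by
    rintro _ ⟨u₁, hu₁, u₂, hu₂, rfl⟩ _ ⟨v₁, hv₁, v₂, hv₂, rfl⟩
    simp only [Pi.add_apply, Finset.sum_add_distrib]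
    rw [hD.sum_eq u₁ hu₁ v₁ hv₁, hE.sum_eq u₂ hu₂ v₂ hv₂]
  exchange := by
    rintro _ ⟨u₁, hu₁, u₂, hu₂, rfl⟩ _ ⟨v₁, hv₁, v₂, hv₂, rfl⟩ i hi
    exact hD.exists_add_exchange hE hv₁ hv₂ _ u₁ hu₁ u₂ hu₂ rfl i hi

theorem IsMConvex.nsmul {D : Set (ι → ℤ)} (hD : IsMConvex D) (k : ℕ) : IsMConvex (k • D) := by
  induction k with
  | zero =>
    rw [zero_nsmul]
    constructor
    · rintro u rfl v rfl; rfl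
    · rintro u rfl v rfl i hi; exact absurd hi (lt_irrefl _)
  | succ k ih => rw [succ_nsmul]; exact ih.add hD

/-- The exchange property with the receiving coordinate `j` prescribed instead of the giving one. The
vector `v` is moved towards `u` as long as this leaves `u j < v j`; in the end `v` itself is an
exchange of `u`. -/
theorem IsMConvex.dual_exchange {D : Set (ι → ℤ)} (hD : IsMConvex D) {u : ι → ℤ} (hu : u ∈ D)
    (N : ℕ) : ∀ v ∈ D, latticeDist v u = N → ∀ j, u j < v j →
      ∃ i, v i < u i ∧ u - Pi.single i 1 + Pi.single j 1 ∈ D := by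
  induction N using Nat.strong_induction_on with
  | _ N ih =>
  intro v hv hN j hj
  -- The second condition keeps `u j < v j` true after lowering `v` at `i`.
  by_cases h : ∃ i, u i < v i ∧ (i = j → u j + 1 < v j)
  · obtain ⟨i, hi, hij⟩ := h
    obtain ⟨l, hl, hm⟩ := hD.exchange v hv u hu i hi
    have hlt := latticeDist_lt_of_exchange hi hl
    obtain ⟨k, hk, hmk⟩ := ih _ (by omega) _ hm rfl j (by
      rw [sub_single_add_single_apply]
      have : j = i → u j + 1 < v j := fun h => hij h.symm
      split_ifs with h1 h2 h2
      · omega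
      · have := this h1; omega
      · omega
      · omega)
    refine ⟨k, ?_, hmk⟩
    rw [sub_single_add_single_apply] at hk
    split_ifs at hk with h1 h2 h2
    · omega
    · subst h1; omega
    · omega
    · omega
  · -- Here `j` is the only coordinate where `v` exceeds `u`, and the excess is one.
    push Not at h
    have hjv : v j = u j + 1 := by have := (h j hj).2; omega
    have hle : ∀ i, i ≠ j → v i ≤ u i := fun i hi => by
      by_contra hc
      exact hi (h i (by omega)).1
    obtain ⟨i, hi⟩ : ∃ i, v i < u i := by
      by_contra! hc
      have : ∑ k, u k < ∑ k, v k :=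
        Finset.sum_lt_sum (fun k _ => hc k) ⟨j, Finset.mem_univ j, hj⟩
      have := hD.sum_eq u hu v hv
      omega
    have hij : i ≠ j := by rintro rfl; omega
    refine ⟨i, hi, ?_⟩
    have hle' : ∀ k, v k ≤ (u - Pi.single i 1 + Pi.single j 1 : ι → ℤ) k := fun k => by
      rw [sub_single_add_single_apply]
      split_ifs with h1 h2 h2
      · exact absurd (h1.symm.trans h2) hij
      · subst h1; omega
      · subst h2; omega
      · have := hle k h2; omega
    have hs := sum_sub_single_add_single Finset.univ u i j
    simp only [Finset.mem_univ, if_true, sub_add_cancel] at hs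
    have heq := (Finset.sum_eq_sum_iff_of_le (fun k _ => hle' k)).1
      ((hD.sum_eq v hv u hu).trans hs.symm)
    rwa [← show v = _ from funext fun k => heq k (Finset.mem_univ k)]

/-- A local minimiser of the `R`-sum is a global one: if some member has a smaller `R`-sum than `y`,
then a single exchange of `y` already moves a unit out of `R`. -/
theorem IsMConvex.exists_exchange_leaving {D : Set (ι → ℤ)} (hD : IsMConvex D) {z : ι → ℤ}
    (hz : z ∈ D) (R : Finset ι) (N : ℕ) : ∀ y ∈ D, latticeDist y z = N →
      ∑ k ∈ R, z k < ∑ k ∈ R, y k →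
      ∃ i ∈ R, ∃ j ∉ R, y - Pi.single i 1 + Pi.single j 1 ∈ D := by
  induction N using Nat.strong_induction_on with
  | _ N ih =>
  intro y hy hN hlt
  obtain ⟨i, hiR, hi⟩ := Finset.exists_lt_of_sum_lt hlt
  obtain ⟨j, hj, hm⟩ := hD.exchange y hy z hz i hi
  by_cases hjR : j ∈ R
  · have hd := latticeDist_lt_of_exchange hi hj
    have hs := sum_sub_single_add_single R y i j
    rw [if_pos hiR, if_pos hjR, sub_add_cancel] at hs
    obtain ⟨i', hiR', j', hjR', hm'⟩ := ih _ (by omega) _ hm rfl (by rwa [hs])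
    have hj'i : j' ≠ i := by rintro rfl; exact hjR' hiR
    have hj'i' : j' ≠ i' := by rintro rfl; exact hjR' hiR'
    -- Two exchanges of `y` lead to a member with excess over `y` at `j'` and deficits only in `R`;
    -- the dual exchange merges them into one.
    obtain ⟨l, hl, hml⟩ := hD.dual_exchange hy _ _ hm' rfl j' (by
      rw [sub_single_add_single_apply, sub_single_add_single_apply, if_neg hj'i, if_neg hj'i',
        if_pos rfl]
      split_ifs <;> omega)
    refine ⟨l, ?_, j', hjR', hml⟩
    by_contra hlR
    have h1 : l ≠ i := by rintro rfl; exact hlR hiR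
    have h2 : l ≠ i' := by rintro rfl; exact hlR hiR'
    rw [sub_single_add_single_apply, sub_single_add_single_apply, if_neg h1, if_neg h2] at hl
    split_ifs at hl <;> omega
  · exact ⟨i, hiR, j, hjR, hm⟩

/-- The relation "a unit of `y` can be moved from `i` to `j` inside `D`" is transitive. -/
theorem IsMConvex.exchange_trans {D : Set (ι → ℤ)} (hD : IsMConvex D) {y : ι → ℤ} {i j k : ι}
    (hij : i ≠ j) (hik : i ≠ k) (h₁ : y - Pi.single i 1 + Pi.single j 1 ∈ D)
    (h₂ : y - Pi.single j 1 + Pi.single k 1 ∈ D) :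
    y - Pi.single i 1 + Pi.single k 1 ∈ D := by
  obtain ⟨l, hl, hm⟩ := hD.exchange _ h₂ _ h₁ i (by
    simp only [sub_single_add_single_apply, if_neg hij, if_neg hik]
    simp)
  have hlj : l = j := by
    by_contra hlj
    simp only [sub_single_add_single_apply, if_neg hlj] at hl
    split_ifs at hl <;> omega
  subst hlj
  convert hm using 1
  abel

/-- An M-convex set contains every integer vector that has the right coordinate sum and satisfies, for
each `R`, the inequality `∑_R x ≥ min_{z ∈ D} ∑_R z`. -/
theorem IsMConvex.mem_of_forall_sum_le {D : Set (ι → ℤ)} (hD : IsMConvex D) {x : ι → ℤ}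
    (hsum : ∀ y ∈ D, ∑ i, y i = ∑ i, x i)
    (hx : ∀ R : Finset ι, ∃ z ∈ D, ∑ i ∈ R, z i ≤ ∑ i ∈ R, x i) : x ∈ D := by
  classical
  have hne : D.Nonempty := (hx ∅).imp fun z hz => hz.1
  obtain ⟨y, hy, hmin⟩ : ∃ y ∈ D, ∀ y' ∈ D, latticeDist y x ≤ latticeDist y' x := by
    exact ⟨Function.argminOn (latticeDist · x) D hne, Function.argminOn_mem _ _ _,
      fun y' hy' => Function.argminOn_le (latticeDist · x) D hy'⟩
  by_contra hxD
  -- `R`: the coordinates where `y` exceeds `x`, and those reachable from them by an exchange of `y`.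
  let R : Finset ι := Finset.univ.filter fun j =>
    x j < y j ∨ ∃ i, x i < y i ∧ y - Pi.single i 1 + Pi.single j 1 ∈ D
  have hR : ∀ j, j ∈ R ↔ x j < y j ∨ ∃ i, x i < y i ∧ y - Pi.single i 1 + Pi.single j 1 ∈ D :=
    fun j => by simp [R]
  have hle : ∀ j ∈ R, x j ≤ y j := fun j hj => by
    rcases (hR j).1 hj with h | ⟨i, hi, hm⟩
    · exact h.le
    · by_contra! hlt
      exact absurd (hmin _ hm) (not_le.2 (latticeDist_lt_of_exchange hi hlt))
  obtain ⟨i₀, hi₀⟩ : ∃ i, x i < y i := by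
    by_contra! hc
    have heq := (Finset.sum_eq_sum_iff_of_le (fun k _ => hc k)).1 (hsum y hy)
    exact hxD (by rwa [← show y = x from funext fun k => heq k (Finset.mem_univ k)])
  have hlt : ∑ i ∈ R, x i < ∑ i ∈ R, y i :=
    Finset.sum_lt_sum hle ⟨i₀, (hR _).2 (Or.inl hi₀), hi₀⟩
  obtain ⟨z, hz, hzx⟩ := hx R
  obtain ⟨i, hi, j, hj, hm⟩ := hD.exists_exchange_leaving hz R _ y hy rfl (hzx.trans_lt hlt)
  refine hj ((hR j).2 (Or.inr ?_))
  by_cases hix : x i < y i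
  · exact ⟨i, hix, hm⟩
  · obtain h | ⟨i', hi', hm'⟩ := (hR i).1 hi
    · exact absurd h hix
    · refine ⟨i', hi', hD.exchange_trans ?_ ?_ hm' hm⟩
      · rintro rfl; exact hix hi'
      · rintro rfl; exact hj ((hR _).2 (Or.inl hi'))

end MConvex

/-! ### Bases of a discrete polymatroid -/

section Polymatroid

variable {n : ℕ}

/-- A vector of natural numbers, as a vector of integers. -/
def toIntVec (u : Fin n →₀ ℕ) : Fin n → ℤ := fun i => (u i : ℤ)

theorem toIntVec_injective : Function.Injective (toIntVec (n := n)) := fun u v h => by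
  ext i
  exact Int.ofNat_inj.1 (congrFun h i)

theorem vecModulus_lt_of_lt {u v : Fin n →₀ ℕ} (h : u < v) : vecModulus u < vecModulus v := by
  obtain ⟨hle, i, hi⟩ := Finsupp.lt_def.1 h
  exact Finset.sum_lt_sum (fun k _ => hle k) ⟨i, Finset.mem_univ i, hi⟩

theorem sum_toIntVec (R : Finset (Fin n)) (u : Fin n →₀ ℕ) :
    ∑ i ∈ R, toIntVec u i = ((∑ i ∈ R, u i : ℕ) : ℤ) := by
  simp [toIntVec]

theorem exists_mem_closure_of_mem_nsmul {B : Set (Fin n →₀ ℕ)} (k : ℕ) :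
    ∀ z ∈ k • (toIntVec '' B), ∃ w ∈ AddSubmonoid.closure B, toIntVec w = z := by
  induction k with
  | zero =>
    rw [zero_nsmul]
    rintro z rfl
    exact ⟨0, zero_mem _, by funext i; simp [toIntVec]⟩
  | succ k ih =>
    rw [succ_nsmul]
    rintro _ ⟨a, ha, _, ⟨b, hb, rfl⟩, rfl⟩
    obtain ⟨w, hw, rfl⟩ := ih a ha
    exact ⟨w + b, add_mem hw (AddSubmonoid.subset_closure hb), by funext i; simp [toIntVec]⟩

namespace IsDiscretePolymatroid

variable {P : Set (Fin n →₀ ℕ)}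

theorem bases_nonempty (hP : IsDiscretePolymatroid P) : (polymatroidBases P).Nonempty := by
  obtain ⟨u, hu⟩ := hP.finite.exists_maximal hP.nonempty
  exact ⟨u, hu.prop, fun v hv h => hu.not_prop_of_gt h hv⟩

theorem vecModulus_le_of_mem_bases (hP : IsDiscretePolymatroid P) {u v : Fin n →₀ ℕ}
    (hu : u ∈ polymatroidBases P) (hv : v ∈ P) : vecModulus v ≤ vecModulus u := by
  by_contra! h
  obtain ⟨w, hw, huw, -⟩ := hP.exchange u hu.1 v hv h
  exact hu.2 w hw huw

theorem vecModulus_eq (hP : IsDiscretePolymatroid P) {u v : Fin n →₀ ℕ}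
    (hu : u ∈ polymatroidBases P) (hv : v ∈ polymatroidBases P) : vecModulus u = vecModulus v :=
  le_antisymm (hP.vecModulus_le_of_mem_bases hv hu.1) (hP.vecModulus_le_of_mem_bases hu hv.1)

theorem mem_bases_of_vecModulus_eq (hP : IsDiscretePolymatroid P) {u v : Fin n →₀ ℕ}
    (hu : u ∈ polymatroidBases P) (hv : v ∈ P) (h : vecModulus v = vecModulus u) :
    v ∈ polymatroidBases P :=
  ⟨hv, fun _ hw hvw => absurd (vecModulus_lt_of_lt hvw)
    (not_lt.2 (h ▸ hP.vecModulus_le_of_mem_bases hu hw))⟩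

theorem isMConvex_bases (hP : IsDiscretePolymatroid P) :
    IsMConvex (toIntVec '' polymatroidBases P) where
  sum_eq := by
    rintro _ ⟨u, hu, rfl⟩ _ ⟨v, hv, rfl⟩
    rw [sum_toIntVec, sum_toIntVec]
    exact congrArg _ (hP.vecModulus_eq hu hv)
  exchange := by
    rintro _ ⟨u, hu, rfl⟩ _ ⟨v, hv, rfl⟩ i hi
    have hi : v i < u i := by simpa [toIntVec] using hi
    have hui : u - Finsupp.single i 1 + Finsupp.single i 1 = u :=
      tsub_add_cancel_of_le (Finsupp.single_le_iff.2 (by omega))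
    have hmod : ∀ (a : Fin n →₀ ℕ) (j : Fin n),
        vecModulus (a + Finsupp.single j 1) = vecModulus a + 1 := fun a j => by
      simp [vecModulus, Finset.sum_add_distrib, Finsupp.single_apply]
    have hm := hmod (u - Finsupp.single i 1) i
    rw [hui] at hm
    have huv := hP.vecModulus_eq hu hv
    obtain ⟨w, hw, huw, hwle⟩ := hP.exchange (u - Finsupp.single i 1)
      (hP.mem_of_le u hu.1 _ tsub_le_self) v hv.1 (by omega)
    obtain ⟨hle, j, hj⟩ := Finsupp.lt_def.1 huw
    have hwj := hwle j
    rw [Finsupp.sup_apply] at hwj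
    have hjv : (u - Finsupp.single i 1 : Fin n →₀ ℕ) j < v j := by
      rcases le_sup_iff.1 hwj with h | h <;> omega
    rw [Finsupp.tsub_apply, Finsupp.single_apply] at hjv
    have hij : i ≠ j := by
      rintro rfl
      rw [if_pos rfl] at hjv; omega
    rw [if_neg hij] at hjv
    refine ⟨j, by simpa [toIntVec] using hjv, u - Finsupp.single i 1 + Finsupp.single j 1,
      hP.mem_bases_of_vecModulus_eq hu (hP.mem_of_le w hw _ fun k => ?_) ?_, ?_⟩
    · have := hle k
      rw [Finsupp.add_apply, Finsupp.single_apply]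
      split_ifs with h
      · subst h; omega
      · omega
    · rw [hmod]; omega
    · funext k
      rw [sub_single_add_single_apply]
      simp only [toIntVec, Finsupp.add_apply, Finsupp.tsub_apply, Finsupp.single_apply]
      simp only [eq_comm (a := k)]
      split_ifs with h1 h2 h2
      · omega
      · subst h1; omega
      · subst h2; omega
      · omega

/-- Sufficient conditions for `x` to be a sum of bases: its modulus is a multiple of the common modulus
`d` of the bases, and it satisfies the homogenised form `r * |x| ≤ d * ∑_R x` of every inequality
`r ≤ ∑_R u` that holds for all bases `u`. -/
theorem mem_closure_bases (hP : IsDiscretePolymatroid P) {d : ℕ}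
    (hd : ∀ u ∈ polymatroidBases P, vecModulus u = d) {x : Fin n →₀ ℕ} (hdvd : d ∣ vecModulus x)
    (hx : ∀ (R : Finset (Fin n)) (r : ℕ), (∀ u ∈ polymatroidBases P, r ≤ ∑ i ∈ R, u i) →
      r * vecModulus x ≤ d * ∑ i ∈ R, x i) :
    x ∈ AddSubmonoid.closure (polymatroidBases P) := by
  rcases Nat.eq_zero_or_pos d with rfl | hd0
  · have h0 : x = 0 := by
      ext i
      exact Finset.sum_eq_zero_iff.1 (zero_dvd_iff.1 hdvd) i (Finset.mem_univ i)
    rw [h0]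
    exact zero_mem _
  obtain ⟨k, hk⟩ := hdvd
  have hnsmul : ∀ u ∈ polymatroidBases P, k • toIntVec u ∈ k • (toIntVec '' polymatroidBases P) :=
    fun u hu => Set.nsmul_mem_nsmul (Set.mem_image_of_mem _ hu)
  have hM := hP.isMConvex_bases.nsmul k
  obtain ⟨b, hb⟩ := hP.bases_nonempty
  suffices h : toIntVec x ∈ k • (toIntVec '' polymatroidBases P) by
    obtain ⟨w, hw, hwx⟩ := exists_mem_closure_of_mem_nsmul k _ h
    rwa [← toIntVec_injective hwx]
  refine hM.mem_of_forall_sum_le (fun y hy => ?_) fun R => ?_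
  · rw [hM.sum_eq y hy _ (hnsmul b hb)]
    simp only [Pi.smul_apply, ← Finset.smul_sum, sum_toIntVec]
    change k • (vecModulus b : ℤ) = (vecModulus x : ℤ)
    rw [hd b hb, hk]
    push_cast
    rw [nsmul_eq_mul, mul_comm]
  · -- The witness is `k • u` for a base `u` with smallest `R`-sum.
    let f : (Fin n →₀ ℕ) → ℕ := fun u => ∑ i ∈ R, u i
    let u := Function.argminOn f (polymatroidBases P) ⟨b, hb⟩
    have hu : u ∈ polymatroidBases P := Function.argminOn_mem f _ _
    refine ⟨_, hnsmul u hu, ?_⟩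
    have hle := hx R (f u) fun v hv => Function.argminOn_le f (polymatroidBases P) hv
    have : k * f u ≤ ∑ i ∈ R, x i := by
      rw [hk] at hle
      refine Nat.le_of_mul_le_mul_left ?_ hd0
      linarith
    simp only [Pi.smul_apply, ← Finset.smul_sum, sum_toIntVec]
    rw [nsmul_eq_mul]
    exact_mod_cast this

end IsDiscretePolymatroid

end Polymatroid

/-! ### Integral closure of monomial algebras -/

section MonomialAlgebra

open MvPolynomial

theorem MvPolynomial.mem_adjoin_monomial_iff {σ K : Type*} [Field K] {S : Set (σ →₀ ℕ)}
    {f : MvPolynomial σ K} :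
    f ∈ Algebra.adjoin K ((fun u => monomial u (1 : K)) '' S) ↔
      ∀ x ∈ f.support, x ∈ AddSubmonoid.closure S := by
  classical
  constructor
  · intro hf
    induction hf using Algebra.adjoin_induction with
    | mem f hf =>
      obtain ⟨u, hu, rfl⟩ := hf
      intro x hx
      rw [Finset.mem_singleton.1 (support_monomial_subset hx)]
      exact AddSubmonoid.subset_closure hu
    | algebraMap r =>
      intro x hx
      rw [algebraMap_eq, C_apply] at hx
      rw [Finset.mem_singleton.1 (support_monomial_subset hx)]
      exact zero_mem _
    | add f g _ _ hf hg =>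
      intro x hx
      exact (Finset.mem_union.1 (support_add hx)).elim (hf x) (hg x)
    | mul f g _ _ hf hg =>
      intro x hx
      obtain ⟨a, ha, b, hb, rfl⟩ := Finset.mem_add.1 (support_mul f g hx)
      exact add_mem (hf a ha) (hg b hb)
  · intro hf
    rw [f.as_sum]
    refine sum_mem fun x hx => ?_
    rw [← mul_one (coeff x f), ← smul_eq_mul, ← smul_monomial]
    refine Subalgebra.smul_mem _ ?_ _
    refine AddSubmonoid.closure_induction (fun u hu => Algebra.subset_adjoin ⟨u, hu, rfl⟩)
      (one_mem _) (fun u v _ _ hu hv => ?_) (hf x hx)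
    have := mul_mem hu hv
    rwa [monomial_mul, mul_one] at this

/-- If `R[X]` is integrally closed, then it is integrally closed in `R[T;T⁻¹]`. -/
theorem mem_range_toLaurent_of_isIntegral {R : Type*} [CommRing R] [IsDomain R]
    [IsIntegrallyClosed (Polynomial R)] {z : LaurentPolynomial R}
    (hz : IsIntegral (Polynomial R) z) : ∃ p : Polynomial R, Polynomial.toLaurent p = z := by
  let F := FractionRing (Polynomial R)
  have hX : Submonoid.powers (Polynomial.X : Polynomial R) ≤ nonZeroDivisors (Polynomial R) :=
    powers_le_nonZeroDivisors_of_noZeroDivisors Polynomial.X_ne_zero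
  let ψ : LaurentPolynomial R →ₐ[Polynomial R] F :=
    IsLocalization.liftAlgHom (M := Submonoid.powers (Polynomial.X : Polynomial R))
      (f := Algebra.ofId (Polynomial R) F) fun y =>
        IsLocalization.map_units F (⟨y, hX y.2⟩ : nonZeroDivisors (Polynomial R))
  have hψ : Function.Injective ψ := by
    refine (IsLocalization.lift_injective_iff _).2 fun x y => ?_
    rw [LaurentPolynomial.algebraMap_eq_toLaurent, LaurentPolynomial.algebraMap_eq_toLaurent,
      Polynomial.toLaurent_inj]
    exact (IsFractionRing.injective (Polynomial R) F).eq_iff.symm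
  obtain ⟨p, hp⟩ := IsIntegrallyClosed.isIntegral_iff.1 (hz.map ψ)
  refine ⟨p, hψ ?_⟩
  rw [← LaurentPolynomial.algebraMap_eq_toLaurent, AlgHom.commutes, hp]

/-- The homomorphism `tᵢ ↦ tᵢ * T ^ wᵢ` into Laurent polynomials over the polynomial ring itself, which
records the weight of each monomial, possibly negative, in the exponent of `T`. -/
noncomputable def MvPolynomial.weightLaurent {σ : Type*} (K : Type*) [CommRing K] (w : σ → ℤ) :
    MvPolynomial σ K →ₐ[K] LaurentPolynomial (MvPolynomial σ K) :=
  aeval fun i => LaurentPolynomial.C (X i) * LaurentPolynomial.T (w i)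

theorem MvPolynomial.weightLaurent_monomial {σ K : Type*} [CommRing K] (w : σ → ℤ) (x : σ →₀ ℕ)
    (c : K) : weightLaurent K w (monomial x c) =
      LaurentPolynomial.C (monomial x c) * LaurentPolynomial.T (Finsupp.weight w x) := by
  induction x using Finsupp.induction_linear generalizing c with
  | zero =>
    rw [map_zero, LaurentPolynomial.T_zero, mul_one, ← C_apply, weightLaurent, aeval_C]
    rfl
  | add x y hx hy =>
    have (c : K) : monomial (x + y) c = monomial x c * monomial y (1 : K) := by
      rw [monomial_mul, mul_one]
    rw [this, map_mul, map_mul, hx, hy, map_add, LaurentPolynomial.T_add]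
    ring
  | single i k =>
    rw [weightLaurent, aeval_monomial, Finsupp.prod_single_index (by simp), mul_pow,
      LaurentPolynomial.T_pow, Finsupp.weight_single, ← C_mul_X_pow_eq_monomial, map_mul, map_pow,
      nsmul_eq_mul, LaurentPolynomial.algebraMap_apply, mul_assoc]
    rfl

theorem MvPolynomial.coeff_weightLaurent {σ K : Type*} [CommRing K] (w : σ → ℤ)
    (f : MvPolynomial σ K) (x : σ →₀ ℕ) :
    coeff x ((weightLaurent K w f).coeff (Finsupp.weight w x)) = coeff x f := by
  classical
  induction f using MvPolynomial.induction_on' with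
  | monomial u c =>
    rw [weightLaurent_monomial, ← LaurentPolynomial.single_eq_C_mul_T, AddMonoidAlgebra.coeff_single,
      Finsupp.single_apply]
    split_ifs with h
    · rfl
    · rw [coeff_zero, coeff_monomial, if_neg]
      rintro rfl
      exact h rfl
  | add p q hp hq => simp [hp, hq]

/-- A linear inequality that holds for the exponents generating a monomial algebra holds for the
exponents of each polynomial integral over it. -/
theorem MvPolynomial.weight_nonneg_of_isIntegral {σ K : Type*} [Field K] {S : Set (σ →₀ ℕ)}
    (w : σ → ℤ) (hS : ∀ u ∈ S, 0 ≤ Finsupp.weight w u) {f : MvPolynomial σ K}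
    (hf : IsIntegral (Algebra.adjoin K ((fun u => monomial u (1 : K)) '' S)) f) :
    ∀ x ∈ f.support, 0 ≤ Finsupp.weight w x := by
  let φ : MvPolynomial σ K →+* LaurentPolynomial (MvPolynomial σ K) :=
    (weightLaurent K w).toRingHom
  -- `O` is the image of `K[t][T]` in the Laurent polynomials.
  let O : Subalgebra (Polynomial (MvPolynomial σ K)) (LaurentPolynomial (MvPolynomial σ K)) := ⊥
  have hmono : ∀ u c, 0 ≤ Finsupp.weight w u → φ (monomial u c) ∈ O := fun u c hu => by
    obtain ⟨m, hm⟩ := Int.eq_ofNat_of_zero_le hu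
    refine Algebra.mem_bot.2 ⟨Polynomial.monomial m (monomial u c), ?_⟩
    rw [LaurentPolynomial.algebraMap_eq_toLaurent, Polynomial.toLaurent_C_mul_T, ← hm]
    exact (weightLaurent_monomial w u c).symm
  have hAO : ∀ a ∈ Algebra.adjoin K ((fun u => monomial u (1 : K)) '' S), φ a ∈ O := by
    intro a ha
    induction ha using Algebra.adjoin_induction with
    | mem a ha =>
      obtain ⟨u, hu, rfl⟩ := ha
      exact hmono u 1 (hS u hu)
    | algebraMap c => exact hmono 0 c (by rw [map_zero])
    | add a b _ _ ha hb => rw [map_add]; exact add_mem ha hb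
    | mul a b _ _ ha hb => rw [map_mul]; exact mul_mem ha hb
  let ψ : Algebra.adjoin K ((fun u => monomial u (1 : K)) '' S) →+* O :=
    (φ.comp (algebraMap _ (MvPolynomial σ K))).codRestrict O fun a => hAO a a.2
  have hO : IsIntegral O (φ f) := hf.map_of_comp_eq ψ φ rfl
  have hφ : IsIntegral (Polynomial (MvPolynomial σ K)) (φ f) := isIntegral_trans (φ f) hO
  obtain ⟨p, hp⟩ := mem_range_toLaurent_of_isIntegral hφ
  intro x hx
  by_contra! hneg
  refine mem_support_iff.1 hx ?_
  rw [← coeff_weightLaurent w f x]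
  change coeff x ((φ f).coeff _) = 0
  rw [← hp, Polynomial.toLaurent_apply, AddMonoidAlgebra.coeff_mapDomain,
    Finsupp.mapDomain_of_notMem_range _ _ (by rintro ⟨m, hm⟩; omega), coeff_zero]

/-- If `g ≠ 0` and `g * f` are homogeneous of degree zero for a grading of the monomials by a group,
so is `f`. -/
theorem MvPolynomial.degree_eq_zero_of_mul {σ K G : Type*} [Field K] [AddCommGroup G]
    (θ : (σ →₀ ℕ) →+ G) {f g h : MvPolynomial σ K} (hg : ∀ x ∈ g.support, θ x = 0)
    (hg0 : g ≠ 0) (hh : ∀ x ∈ h.support, θ x = 0) (hgf : g * f = h) :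
    ∀ x ∈ f.support, θ x = 0 := by
  classical
  -- The part `f₁` of `f` in nonzero degrees is killed by `g`.
  let f₀ := ∑ x ∈ f.support with θ x = 0, monomial x (coeff x f)
  let f₁ := ∑ x ∈ f.support with ¬ θ x = 0, monomial x (coeff x f)
  have hf : f₀ + f₁ = f :=
    (Finset.sum_filter_add_sum_filter_not _ _ _).trans f.as_sum.symm
  have hf₀ : ∀ x ∈ f₀.support, θ x = 0 := fun x hx => by
    obtain ⟨y, hy, hxy⟩ := Finset.mem_biUnion.1 (support_sum hx)
    rw [Finset.mem_singleton.1 (support_monomial_subset hxy)]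
    exact (Finset.mem_filter.1 hy).2
  have hf₁ : ∀ x ∈ f₁.support, ¬ θ x = 0 := fun x hx => by
    obtain ⟨y, hy, hxy⟩ := Finset.mem_biUnion.1 (support_sum hx)
    rw [Finset.mem_singleton.1 (support_monomial_subset hxy)]
    exact (Finset.mem_filter.1 hy).2
  have hgf₁ : g * f₁ = h - g * f₀ := by rw [← hgf, ← hf]; ring
  have hzero : g * f₁ = 0 := by
    by_contra hne
    obtain ⟨x, hx⟩ := support_nonempty.2 hne
    have hθ : ¬ θ x = 0 := by
      obtain ⟨a, ha, b, hb, rfl⟩ := Finset.mem_add.1 (support_mul g f₁ hx)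
      rw [map_add, hg a ha, zero_add]
      exact hf₁ b hb
    rw [hgf₁] at hx
    rcases Finset.mem_union.1 (support_sub _ _ _ hx) with hx | hx
    · exact hθ (hh x hx)
    · obtain ⟨a, ha, b, hb, rfl⟩ := Finset.mem_add.1 (support_mul g f₀ hx)
      exact hθ (by rw [map_add, hg a ha, hf₀ b hb, add_zero])
  rw [(mul_eq_zero.1 hzero).resolve_left hg0, add_zero] at hf
  rwa [← hf]

/-- A subalgebra `A` of an integrally closed domain `R` is integrally closed if it contains each
element of `R` that is integral over `A` and a quotient of elements of `A`. -/
theorem Subalgebra.isIntegrallyClosed_of_forall {K R : Type*} [Field K] [CommRing R] [IsDomain R]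
    [Algebra K R] [IsIntegrallyClosed R] (A : Subalgebra K R)
    (hA : ∀ f g : R, g ∈ A → g ≠ 0 → g * f ∈ A → IsIntegral A f → f ∈ A) :
    IsIntegrallyClosed A := by
  rw [isIntegrallyClosed_iff (FractionRing A)]
  intro x hx
  obtain ⟨h, g, hg, rfl⟩ := IsFractionRing.div_surjective (A := A) x
  have hg0 : g ≠ 0 := nonZeroDivisors.ne_zero hg
  let L := FractionRing R
  have hinj : Function.Injective (algebraMap A L) :=
    (IsFractionRing.injective R L).comp Subtype.val_injective
  let ψ : FractionRing A →ₐ[A] L := IsFractionRing.liftAlgHom (g := Algebra.ofId A L) hinj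
  have hLA : IsIntegral A (ψ (algebraMap A _ h / algebraMap A _ g)) := hx.map ψ
  have hval : ψ (algebraMap A _ h / algebraMap A _ g) =
      algebraMap R L (h : R) / algebraMap R L (g : R) := by
    rw [map_div₀, AlgHom.commutes, AlgHom.commutes]; rfl
  obtain ⟨f, hf⟩ := IsIntegrallyClosed.isIntegral_iff.1 (hLA.tower_top (A := R))
  rw [← hf, isIntegral_algebraMap_iff (IsFractionRing.injective R L)] at hLA
  have hg0' : (g : R) ≠ 0 := fun h => hg0 (Subtype.ext h)
  have hgf : (g : R) * f = h := by
    apply IsFractionRing.injective R L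
    rw [map_mul, hf, hval, mul_div_cancel₀]
    exact fun h0 => hg0' (IsFractionRing.injective R L (by rw [h0, map_zero]))
  refine ⟨⟨f, hA f g g.2 hg0' (hgf ▸ h.2) hLA⟩, ?_⟩
  rw [eq_div_iff, ← map_mul]
  · congr 1
    exact Subtype.ext ((mul_comm _ _).trans hgf)
  · exact fun h0 => hg0 (IsFractionRing.injective A (FractionRing A) (by rw [h0, map_zero]))

end MonomialAlgebra

/-! ### Normality of the base ring -/

theorem corollary6p2 {K : Type*} [Field K] {n : ℕ} (P : Set (Fin n →₀ ℕ))
    (hP : IsDiscretePolymatroid P) :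
    IsDomain (baseRing K P) ∧ IsIntegrallyClosed (baseRing K P) := by
  refine ⟨inferInstance, Subalgebra.isIntegrallyClosed_of_forall _ fun f g hg hg0 hgf hf => ?_⟩
  obtain ⟨b, hb⟩ := hP.bases_nonempty
  have hd : ∀ u ∈ polymatroidBases P, vecModulus u = vecModulus b := fun u hu =>
    hP.vecModulus_eq hu hb
  let θ : (Fin n →₀ ℕ) →+ ZMod (vecModulus b) :=
    (Nat.castAddMonoidHom (ZMod (vecModulus b))).comp Finsupp.degree
  have hθ : ∀ x, θ x = (vecModulus x : ZMod (vecModulus b)) := fun x =>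
    congrArg Nat.cast (Finsupp.degree_eq_sum x)
  have hmod : ∀ a ∈ baseRing K P, ∀ x ∈ a.support, θ x = 0 := fun a ha x hx => by
    refine AddSubmonoid.closure_induction (fun u hu => ?_) (map_zero _)
      (fun u v _ _ hu hv => by rw [map_add, hu, hv, add_zero])
      (MvPolynomial.mem_adjoin_monomial_iff.1 ha x hx)
    rw [hθ, hd u hu, ZMod.natCast_self]
  refine MvPolynomial.mem_adjoin_monomial_iff.2 fun x hx => hP.mem_closure_bases hd ?_ ?_
  · rw [← ZMod.natCast_eq_zero_iff, ← hθ]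
    exact MvPolynomial.degree_eq_zero_of_mul θ (hmod g hg) hg0 (hmod _ hgf) rfl x hx
  · intro R r hr
    -- The weight of `y` is `d * ∑_R y - r * |y|`, where `d = |b|`.
    let wt : Fin n → ℤ := fun i => (vecModulus b : ℤ) * (if i ∈ R then 1 else 0) - r
    have hw : ∀ y : Fin n →₀ ℕ, Finsupp.weight wt y =
        (vecModulus b : ℤ) * (∑ i ∈ R, y i : ℕ) - r * (vecModulus y : ℕ) := fun y => by
      rw [Finsupp.weight_eq_sum]
      simp only [wt, nsmul_eq_mul, mul_sub, Finset.sum_sub_distrib, vecModulus]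
      push_cast
      rw [Finset.mul_sum, Finset.mul_sum]
      congr 1
      · simp [mul_comm]
      · exact Finset.sum_congr rfl fun i _ => mul_comm _ _
    have h := MvPolynomial.weight_nonneg_of_isIntegral wt (fun u hu => ?_) hf x hx
    · rw [hw] at h
      have : (r * vecModulus x : ℤ) ≤ vecModulus b * (∑ i ∈ R, x i : ℕ) := by linarith
      exact_mod_cast this
    · rw [hw, hd u hu, sub_nonneg, mul_comm]
      gcongr
      exact hr u hu
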